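/- Let $\Omega\subset\mathbb R^3$ be an open set whose closure is the union of a finite face-to-face subdivision into nondegenerate tetrahedra, let $\mathcal T$ and $\mathcal S$ be two such subdivisions of $\Omega$ (possibly equal), and let $k,d,m,r\ge 0$ be integers with $r\le d$. Write $\|\cdot\|$ and $(\cdot,\cdot)$ for the $L^2(\Omega)$ norm and inner product of scalar, vector and tensor fields, and set $$\mathbf V=\{\mathbf v\in H^1_0(\Omega)^3:\ \operatorname{div}\mathbf v=0\}.$$ Finite element spaces: - $\mathbf X_h$ is the space of vector fields whose components are, on each $K\in\mathcal T$, polynomials of degree at most $d$ (no continuity required). - $\pi_h$ is the $L^2$-projection onto the vector fields whose components are, on each $K\in\mathcal T$, polynomials of degree at most $r$. For $r=0$ it takes the average over each $K$; for $r=d$ it is the $L^2$-projection onto $\mathbf X_h$. - $U_h$ is the space of functions in $H^1(\Omega)$ that are polynomials of degree at most $k$ on each $K\in\mathcal T$. - $\mathbf{RT}_h$ is the space of tensor fields $\mathbf p\in H(\operatorname{div};\Omega)^3$ each of whose rows has on each $K\in\mathcal T$ the form $(a_1+c\,x_1,\ a_2+c\,x_2,\ a_3+c\,x_3)$ with polynomials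 $a_1,a_2,a_3,c$ of degree at most $m$. - $\mathbf V_h$ (the Scott–Vogelius space) is the space of $\mathbf v\in\mathbf V$ whose components are polynomials of degree at most $k$ on each $K\in\mathcal S$. For $\mathbf v\in\mathbf V$, its projection $P_h\mathbf v\in\mathbf V_h$ is defined by $(\nabla(\mathbf v-P_h\mathbf v),\nabla\mathbf v_h)=0$ for all $\mathbf v_h\in\mathbf V_h$. Define, with values in $[0,\infty]$ and $\inf\emptyset=\infty$, $\sup\emptyset=0$, $$\kappa_h=\sup_{0\ne\mathbf f_h\in\mathbf X_h}\ \inf_{\mathbf p_h,\ \mathbf v_h}\ \frac{\|\mathbf p_h-\nabla\mathbf v_h\|}{\|\mathbf f_h\|},\qquad C_{0,h}=\sup_{0\ne\mathbf v\in\mathbf V}\frac{\|\mathbf v-\pi_h\mathbf v\|}{\|\nabla\mathbf v\|},\qquad C_h=\sqrt{\kappa_h^2+C_{0,h}^2},$$ where the infimum is over all $\mathbf v_h\in\mathbf V_h$ and all $\mathbf p_h\in\mathbf{RT}_h$ with $\operatorname{div}\mathbf p_h+\nabla\phi_h+\mathbf f_h=0$ for some $\phi_h\in U_h$. **Theorem.**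 Let $\mathbf f\in L^2(\Omega)^3$. There is exactly one $\mathbf u\in\mathbf V$ with $(\nabla\mathbf u,\nabla\mathbf v)=(\mathbf f,\mathbf v)$ for all $\mathbf v\in\mathbf V$ (the weak Stokes solution), the projection $P_h\mathbf v$ exists and is unique for every $\mathbf v\in\mathbf V$, and $$\|\nabla(\mathbf u-P_h\mathbf u)\|\le C_h\|\mathbf f\|,\qquad \|\mathbf u-P_h\mathbf u\|\le C_h\|\nabla(\mathbf u-P_h\mathbf u)\|.$$ -/

import Mathlib

open MeasureTheory Filter Topology
open scoped ENNReal ContDiff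

noncomputable section

namespace Stokes

/-- Three-dimensional Euclidean space. -/
abbrev E3 : Type := EuclideanSpace ℝ (Fin 3)

/-- Real `3 × 3` arrays with the Frobenius norm. -/
abbrev M3 : Type := EuclideanSpace ℝ (Fin 3 × Fin 3)

/-- The scalar space `L²(Ω)`. -/
abbrev L2s (Ω : Set E3) : Type := Lp ℝ 2 (volume.restrict Ω)

/-- The vector space `L²(Ω)³`. -/
abbrev L2v (Ω : Set E3) : Type := Lp E3 2 (volume.restrict Ω)

/-- The tensor space `L²(Ω)³ˣ³`. -/
abbrev L2m (Ω : Set E3) : Type := Lp M3 2 (volume.restrict Ω)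

/-! ### Sobolev spaces through weak derivatives -/

/-- Test functions: members of `C_c^∞(Ω)`. -/
def IsTest (Ω : Set E3) (φ : E3 → ℝ) : Prop :=
  ContDiff ℝ ∞ φ ∧ HasCompactSupport φ ∧ tsupport φ ⊆ Ω

/-- The classical partial derivative `∂φ/∂x_j`. -/
def pderiv (j : Fin 3) (φ : E3 → ℝ) (x : E3) : ℝ :=
  fderiv ℝ φ x (EuclideanSpace.single j 1)

/-- `g` is the weak partial derivative `∂u/∂x_j` in `Ω`. -/
def HasWeakPartial (Ω : Set E3) (j : Fin 3) (u g : E3 → ℝ) : Prop :=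
  ∀ φ : E3 → ℝ, IsTest Ω φ →
    ∫ x in Ω, u x * pderiv j φ x = - ∫ x in Ω, g x * φ x

/-- `g` is the weak gradient of the scalar function `φ`; `φ` is in `H¹(Ω)` if such a `g` exists. -/
def HasGrad {Ω : Set E3} (φ : L2s Ω) (g : L2v Ω) : Prop :=
  ∀ j, HasWeakPartial Ω j (fun x => φ x) (fun x => g x j)

/-- `G` is the weak gradient of the vector field `u`, with entries `G (i, j) = ∂u_i/∂x_j`;
`u` is in `H¹(Ω)³` if such a `G` exists. -/
def HasGradV {Ω : Set E3} (u : L2v Ω) (G : L2m Ω) : Prop :=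
  ∀ i j, HasWeakPartial Ω j (fun x => u x i) (fun x => G x (i, j))

open Classical in
/-- The weak gradient `∇u` of a vector field `u` in `H¹(Ω)³` (it is unique when `Ω` is open);
by convention `0` for the other `u`. -/
def gradV {Ω : Set E3} (u : L2v Ω) : L2m Ω :=
  if h : ∃ G : L2m Ω, HasGradV u G then h.choose else 0

/-- `g` is the weak divergence of the vector field `w` in `Ω`. -/
def HasWeakDiv (Ω : Set E3) (w : E3 → Fin 3 → ℝ) (g : E3 → ℝ) : Prop :=
  ∀ φ : E3 → ℝ, IsTest Ω φ →
    ∫ x in Ω, ∑ j, w x j * pderiv j φ x = - ∫ x in Ω, g x * φ x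

/-- `g` is the row-wise weak divergence of the tensor field `p`: `g_i = ∑_j ∂p_ij/∂x_j`;
`p` is in `H(div; Ω)³` if such a `g` exists. -/
def HasDivM {Ω : Set E3} (p : L2m Ω) (g : L2v Ω) : Prop :=
  ∀ i, HasWeakDiv Ω (fun x j => p x (i, j)) (fun x => g x i)

/-- `H¹₀(Ω)³`: the vector fields in `H¹(Ω)³` that are limits, in the `H¹` norm, of fields with
components in `C_c^∞(Ω)`. -/
def H10 (Ω : Set E3) : Set (L2v Ω) :=
  {u | ∃ G : L2m Ω, HasGradV u G ∧ ∃ φ : ℕ → Fin 3 → E3 → ℝ,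
    (∀ n i, IsTest Ω (φ n i)) ∧
    (∀ i, Tendsto (fun n => eLpNorm (fun x => u x i - φ n i x) 2 (volume.restrict Ω))
      atTop (𝓝 0)) ∧
    (∀ i j, Tendsto
      (fun n => eLpNorm (fun x => G x (i, j) - pderiv j (φ n i) x) 2 (volume.restrict Ω))
      atTop (𝓝 0))}

/-- `V = {v ∈ H¹₀(Ω)³ : div v = 0}`. -/
def V (Ω : Set E3) : Set (L2v Ω) :=
  {v | v ∈ H10 Ω ∧ HasWeakDiv Ω (fun x j => v x j) 0}

/-- `u` is the weak solution of the Stokes problem with load `f`: `u ∈ V` and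
`(∇u, ∇v) = (f, v)` for all `v ∈ V`. -/
def IsStokesSolution {Ω : Set E3} (f u : L2v Ω) : Prop :=
  u ∈ V Ω ∧ ∀ v ∈ V Ω, inner ℝ (gradV u) (gradV v) = inner ℝ f v

/-! ### Finite element spaces -/

/-- A face-to-face subdivision of (the closure of) `Ω` into finitely many nondegenerate
tetrahedra, each given by its set of four vertices. -/
structure TetMesh (Ω : Set E3) where
  cells : Finset (Finset E3)
  card_cell : ∀ K ∈ cells, K.card = 4
  nondegenerate : ∀ K ∈ cells, AffineIndependent ℝ ((↑) : K → E3)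
  cover : ⋃ K ∈ cells, convexHull ℝ (K : Set E3) = closure Ω
  conforming : ∀ K ∈ cells, ∀ L ∈ cells,
    convexHull ℝ (K : Set E3) ∩ convexHull ℝ (L : Set E3) =
      convexHull ℝ ((K : Set E3) ∩ (L : Set E3))

/-- On each tetrahedron of the mesh, `g` is a polynomial of degree at most `d`. -/
def IsPiecewisePoly {Ω : Set E3} (T : TetMesh Ω) (d : ℕ) (g : E3 → ℝ) : Prop :=
  ∀ K ∈ T.cells, ∃ q : MvPolynomial (Fin 3) ℝ, q.totalDegree ≤ d ∧
    ∀ᵐ x ∂(volume.restrict Ω), x ∈ convexHull ℝ (K : Set E3) →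
      g x = MvPolynomial.eval (fun i => x i) q

/-- The discontinuous space `X_h³` of vector fields that are piecewise polynomial of degree at
most `d`. -/
def Xh {Ω : Set E3} (T : TetMesh Ω) (d : ℕ) : Submodule ℝ (L2v Ω) where
  carrier := {f | ∀ i, IsPiecewisePoly T d (fun x => f x i)}
  zero_mem' := by
    intro i K _
    refine ⟨0, by simp, ?_⟩
    filter_upwards [Lp.coeFn_zero E3 2 (volume.restrict Ω)] with x hx _
    exact (congrArg (fun y : E3 => y i) hx).trans (by simp)
  add_mem' := by
    intro f g hf hg i K hK
    obtain ⟨a, ha, ha'⟩ := hf i K hK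
    obtain ⟨b, hb, hb'⟩ := hg i K hK
    refine ⟨a + b, (MvPolynomial.totalDegree_add a b).trans (max_le ha hb), ?_⟩
    filter_upwards [Lp.coeFn_add f g, ha', hb'] with x hx h1 h2 hxK
    refine (congrArg (fun y : E3 => y i) hx).trans ?_
    exact (congrArg₂ (· + ·) (h1 hxK) (h2 hxK)).trans (by simp)
  smul_mem' := by
    intro c f hf i K hK
    obtain ⟨a, ha, ha'⟩ := hf i K hK
    refine ⟨c • a, (MvPolynomial.totalDegree_smul_le c a).trans ha, ?_⟩
    filter_upwards [Lp.coeFn_smul c f, ha'] with x hx h1 hxK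
    refine (congrArg (fun y : E3 => y i) hx).trans ?_
    exact (congrArg (c * ·) (h1 hxK)).trans (by simp)

/-- Pairs of a piecewise polynomial field and its polynomials on the tetrahedra. -/
def polyPairs {Ω : Set E3} (T : TetMesh Ω) (d : ℕ) :
    Submodule ℝ (L2v Ω × (T.cells → Fin 3 → MvPolynomial.restrictTotalDegree (Fin 3) ℝ d)) where
  carrier := {z | ∀ (K : T.cells) (i : Fin 3), ∀ᵐ x ∂(volume.restrict Ω),
    x ∈ convexHull ℝ (K.1 : Set E3) →
      z.1 x i = MvPolynomial.eval (fun i => x i) (z.2 K i : MvPolynomial (Fin 3) ℝ)}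
  zero_mem' := by
    intro K i
    filter_upwards [Lp.coeFn_zero E3 2 (volume.restrict Ω)] with x hx _
    exact (congrArg (fun y : E3 => y i) hx).trans (by simp)
  add_mem' := by
    intro y z hy hz K i
    filter_upwards [Lp.coeFn_add y.1 z.1, hy K i, hz K i] with x hx h1 h2 hxK
    refine (congrArg (fun y : E3 => y i) hx).trans ?_
    exact (congrArg₂ (· + ·) (h1 hxK) (h2 hxK)).trans (by simp)
  smul_mem' := by
    intro c z hz K i
    filter_upwards [Lp.coeFn_smul c z.1, hz K i] with x hx h1 hxK
    refine (congrArg (fun y : E3 => y i) hx).trans ?_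
    exact (congrArg (c * ·) (h1 hxK)).trans (by simp)

instance finiteDimensional_Xh {Ω : Set E3} (T : TetMesh Ω) (d : ℕ) :
    FiniteDimensional ℝ (Xh T d) := by
  let second := (LinearMap.snd ℝ (L2v Ω)
    (T.cells → Fin 3 → MvPolynomial.restrictTotalDegree (Fin 3) ℝ d)).comp
      (polyPairs T d).subtype
  have hinj : Function.Injective second := by
    rw [injective_iff_map_eq_zero]
    rintro ⟨⟨f, q⟩, hz⟩ h0
    replace h0 : q = 0 := h0
    subst h0
    have hf : f = 0 := by
      apply Lp.ext
      have hall : ∀ᵐ x ∂(volume.restrict Ω), ∀ (K : T.cells) (i : Fin 3),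
          x ∈ convexHull ℝ (K.1 : Set E3) → f x i = 0 := by
        rw [ae_all_iff]
        intro K
        rw [ae_all_iff]
        intro i
        filter_upwards [hz K i] with x hx hxK
        simpa using hx hxK
      have hΩ : ∀ᵐ x ∂(volume.restrict Ω), x ∈ closure Ω :=
        ae_mono (Measure.restrict_mono subset_closure le_rfl)
          (ae_restrict_mem isClosed_closure.measurableSet)
      filter_upwards [hall, hΩ, Lp.coeFn_zero E3 2 (volume.restrict Ω)] with x h1 h2 h3
      rw [h3]
      rw [← T.cover] at h2
      obtain ⟨K, hK, hxK⟩ := Set.mem_iUnion₂.1 h2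
      ext i
      exact h1 ⟨K, hK⟩ i hxK
    subst hf
    rfl
  have : FiniteDimensional ℝ (polyPairs T d) := FiniteDimensional.of_injective second hinj
  let first := (LinearMap.fst ℝ (L2v Ω)
    (T.cells → Fin 3 → MvPolynomial.restrictTotalDegree (Fin 3) ℝ d)).comp
      (polyPairs T d).subtype
  have hle : Xh T d ≤ LinearMap.range first := by
    intro f hf
    choose q hq hq' using hf
    refine ⟨⟨(f, fun K i => ⟨q i K.1 K.2, ?_⟩), ?_⟩, rfl⟩
    · rw [MvPolynomial.mem_restrictTotalDegree]
      exact hq i K.1 K.2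
    · intro K i
      exact hq' i K.1 K.2
  exact Submodule.finiteDimensional_of_le hle

/-- The `L²` projection `π_h` onto the piecewise polynomial vector fields of degree at most `r`;
for `r = 0` it takes the average over each tetrahedron. -/
def piH {Ω : Set E3} (T : TetMesh Ω) (r : ℕ) (u : L2v Ω) : L2v Ω :=
  (Xh T r).starProjection u

/-- The conforming scalar space `U_h`: the piecewise polynomials of degree at most `k` that are
in `H¹(Ω)`. -/
def Uh {Ω : Set E3} (T : TetMesh Ω) (k : ℕ) : Set (L2s Ω) :=
  {φ | IsPiecewisePoly T k (fun x => φ x) ∧ ∃ g : L2v Ω, HasGrad φ g}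

/-- The Scott–Vogelius space `V_h = U_h³ ∩ V` of exactly divergence-free conforming fields that
vanish on the boundary. -/
def Vh {Ω : Set E3} (T : TetMesh Ω) (k : ℕ) : Set (L2v Ω) :=
  {v | v ∈ V Ω ∧ ∀ i, IsPiecewisePoly T k (fun x => v x i)}

/-- The tensor Raviart–Thomas space of degree `m`: the `p ∈ H(div; Ω)³` each of whose rows has, on
each tetrahedron, the form `(a₁ + c x₁, a₂ + c x₂, a₃ + c x₃)` with `a₁, a₂, a₃, c` polynomials of
degree at most `m`. -/
def RTh {Ω : Set E3} (T : TetMesh Ω) (m : ℕ) : Set (L2m Ω) :=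
  {p | (∃ g : L2v Ω, HasDivM p g) ∧ ∀ i, ∀ K ∈ T.cells,
    ∃ (a : Fin 3 → MvPolynomial (Fin 3) ℝ) (c : MvPolynomial (Fin 3) ℝ),
      (∀ j, (a j).totalDegree ≤ m) ∧ c.totalDegree ≤ m ∧
      ∀ᵐ x ∂(volume.restrict Ω), x ∈ convexHull ℝ (K : Set E3) → ∀ j,
        p x (i, j) = MvPolynomial.eval (fun l => x l) (a j)
          + MvPolynomial.eval (fun l => x l) c * x j}

/-- `w = P_h v`: the projection of `v` onto `V_h`, i.e. `w ∈ V_h` and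
`(∇(v - w), ∇v_h) = 0` for all `v_h ∈ V_h`. -/
def IsPh {Ω : Set E3} (T : TetMesh Ω) (k : ℕ) (v w : L2v Ω) : Prop :=
  w ∈ Vh T k ∧ ∀ z ∈ Vh T k, inner ℝ (gradV (v - w)) (gradV z) = 0

/-! ### The constants -/

/-- The tensors `p_h` in the Raviart–Thomas space with `div p_h + ∇φ_h + f_h = 0` for some
`φ_h ∈ U_h`. -/
def admissible {Ω : Set E3} (T : TetMesh Ω) (k m : ℕ) (f : L2v Ω) : Set (L2m Ω) :=
  {p | p ∈ RTh T m ∧ ∃ φ ∈ Uh T k, ∃ g : L2v Ω, ∃ D : L2v Ω,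
    HasGrad φ g ∧ HasDivM p D ∧ D + g + f = 0}

/-- `κ_h`, with values in `[0, ∞]`. The mesh `T` carries `X_h`, `RT_h` and `U_h`, the mesh `S`
carries `V_h`; the two may be equal. -/
def kappaH {Ω : Set E3} (T S : TetMesh Ω) (k d m : ℕ) : ℝ≥0∞ :=
  ⨆ f ∈ Xh T d, ⨆ (_ : f ≠ 0),
    ⨅ p ∈ admissible T k m f, ⨅ v ∈ Vh S k, ‖p - gradV v‖ₑ / ‖f‖ₑ

/-- `C_{0,h}`: the best constant in `‖v - π_h v‖ ≤ C ‖∇v‖` for `v ∈ V`, with values in `[0, ∞]`. -/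
def C0h {Ω : Set E3} (T : TetMesh Ω) (r : ℕ) : ℝ≥0∞ :=
  ⨆ v ∈ V Ω, ⨆ (_ : v ≠ 0), ‖v - piH T r v‖ₑ / ‖gradV v‖ₑ

/-- `C_h = √(κ_h² + C_{0,h}²)`. -/
def Ch {Ω : Set E3} (T S : TetMesh Ω) (k d m r : ℕ) : ℝ≥0∞ :=
  (kappaH T S k d m ^ 2 + C0h T r ^ 2) ^ (1 / 2 : ℝ)

end Stokes

end

/-! Everything is carried out on the graph of the gradient over `V Ω`, a closed subspace of L² × L²
on which the Poincaré inequality bounds the field by its gradient. Existence then follows from Riesz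
representation, and P_h is an orthogonal projection of gradients onto a finite-dimensional space.

If p satisfies (p, ∇v) = (f, v) on V, then p - ∇u is orthogonal to gradients from V, so ‖p - ∇v_h‖
bounds the Galerkin error (`IsGalerkin.norm_sub_le_of_equilibrium`). Admissible Raviart–Thomas
tensors have this property because the pressure gradient is orthogonal to V
(`inner_snd_of_mem_admissible`). Hence the error is at most κ_h‖f_h‖ for loads f_h in X_h.

A general load is split orthogonally into π_h f and f - π_h f. The first part costs κ_h. The second
changes the gradient of the solution by at most C_{0,h}‖f - π_h f‖, since f - π_h f only sees v -
π_h v. Cauchy–Schwarz combines the two into C_h (`IsGalerkin.norm_sub_le_of_projection`). The L²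
bound is Aubin–Nitsche duality, with the energy bound applied to the load u - P_h u
(`IsGalerkin.norm_fst_sub_le`). -/

namespace Stokes

/-! ### Variational problems and Galerkin errors in Hilbert spaces -/

section Abstract

variable {H M : Type*} [NormedAddCommGroup H] [InnerProductSpace ℝ H]
  [NormedAddCommGroup M] [InnerProductSpace ℝ M]

/-- `z = (u, ∇u)` solves the variational problem with load `f` on the graph `W`. -/
def IsVarSol (W : Submodule ℝ (H × M)) (f : H) (z : H × M) : Prop :=
  z ∈ W ∧ ∀ w ∈ W, inner ℝ z.2 w.2 = inner ℝ f w.1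

/-- `w` is the Galerkin projection of `z` onto `Wh`. -/
def IsGalerkin (Wh : Submodule ℝ (H × M)) (z w : H × M) : Prop :=
  w ∈ Wh ∧ ∀ y ∈ Wh, inner ℝ (z.2 - w.2) y.2 = 0

theorem exists_isVarSol [CompleteSpace H] [CompleteSpace M] {W : Submodule ℝ (H × M)}
    (hW : IsClosed (W : Set (H × M))) {C : ℝ} (hC : ∀ z ∈ W, ‖z.1‖ ≤ C * ‖z.2‖) (f : H) :
    ∃ z, IsVarSol W f z := by
  have hWc : CompleteSpace W := hW.completeSpace_coe
  let g : W →L[ℝ] M := (ContinuousLinearMap.snd ℝ H M).comp W.subtypeL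
  -- The product carries the maximum norm, hence the constant `max C 1`. The gradients of `W` thus
  -- form a complete space `R`, on which Riesz representation applies in the energy inner product.
  have hg : AntilipschitzWith (Real.toNNReal (max C 1)) g := by
    refine AddMonoidHomClass.antilipschitz_of_bound g fun z => ?_
    rw [Real.coe_toNNReal _ (le_max_of_le_right zero_le_one)]
    refine max_le ((hC z.1 z.2).trans ?_) ?_
    · exact mul_le_mul_of_nonneg_right (le_max_left _ _) (norm_nonneg _)
    · exact le_mul_of_one_le_left (norm_nonneg _) (le_max_right _ _)
  have hR : IsComplete (Set.range g) := hg.isComplete_range g.uniformContinuous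
  let R := LinearMap.range (g : W →ₗ[ℝ] M)
  have : CompleteSpace R := IsComplete.completeSpace_coe hR
  let e := LinearEquiv.ofInjective (g : W →ₗ[ℝ] M) hg.injective
  let l₀ : R →ₗ[ℝ] ℝ := ((innerₗ H f).comp (LinearMap.fst ℝ H M)).comp
    (W.subtype.comp e.symm.toLinearMap)
  let l : R →L[ℝ] ℝ := l₀.mkContinuous (‖f‖ * C) fun ξ => by
    obtain ⟨w, rfl⟩ := e.surjective ξ
    have h1 : l₀ (e w) = inner ℝ f w.1.1 := by simp [l₀]
    rw [h1, mul_assoc]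
    exact (abs_real_inner_le_norm _ _).trans
      (mul_le_mul_of_nonneg_left (hC w.1 w.2) (norm_nonneg _))
  obtain ⟨z, hz⟩ := e.surjective ((InnerProductSpace.toDual ℝ R).symm l)
  refine ⟨z.1, z.2, fun w hw => ?_⟩
  have h2 : inner ℝ (e z) (e ⟨w, hw⟩) = l (e ⟨w, hw⟩) := by
    rw [hz, InnerProductSpace.toDual_symm_apply]
  have h3 : l (e ⟨w, hw⟩) = inner ℝ f w.1 := by simp [l, l₀]
  rw [h3] at h2
  exact h2

theorem IsVarSol.sub {W : Submodule ℝ (H × M)} {f f' : H} {z z' : H × M}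
    (hz : IsVarSol W f z) (hz' : IsVarSol W f' z') : IsVarSol W (f - f') (z - z') :=
  ⟨W.sub_mem hz.1 hz'.1, fun w hw => by
    rw [Prod.snd_sub, inner_sub_left, inner_sub_left, hz.2 w hw, hz'.2 w hw]⟩

theorem IsVarSol.snd_eq {W : Submodule ℝ (H × M)} {f : H} {z z' : H × M}
    (hz : IsVarSol W f z) (hz' : IsVarSol W f z') : z.2 = z'.2 := by
  have h := (hz.sub hz').2 _ (hz.sub hz').1
  rw [sub_self, inner_zero_left, inner_self_eq_zero] at h
  exact sub_eq_zero.1 h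

/-- Only gradients matter: any preimage of the orthogonal projection of `z.2` onto the second
components of `Wh` works. -/
theorem exists_isGalerkin (Wh : Submodule ℝ (H × M)) [FiniteDimensional ℝ Wh] (z : H × M) :
    ∃ w, IsGalerkin Wh z w := by
  let R := Wh.map (LinearMap.snd ℝ H M)
  obtain ⟨w, hw, hw'⟩ := R.starProjection_apply_mem z.2
  refine ⟨w, hw, fun y hy => ?_⟩
  rw [show w.2 = R.starProjection z.2 from hw']
  exact R.starProjection_inner_eq_zero z.2 y.2 ⟨y, hy, rfl⟩

theorem IsGalerkin.snd_eq {Wh : Submodule ℝ (H × M)} {z w w' : H × M}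
    (hw : IsGalerkin Wh z w) (hw' : IsGalerkin Wh z w') : w.2 = w'.2 := by
  have hmem := Wh.sub_mem hw'.1 hw.1
  have h := sub_eq_zero.2 ((hw.2 _ hmem).trans (hw'.2 _ hmem).symm)
  rw [← inner_sub_left, sub_sub_sub_cancel_left, Prod.snd_sub, inner_self_eq_zero] at h
  exact (sub_eq_zero.1 h).symm

theorem norm_le_of_inner_sub_eq_zero {a b : M} (h : inner ℝ a (b - a) = 0) : ‖a‖ ≤ ‖b‖ := by
  have h1 := norm_add_sq_eq_norm_sq_add_norm_sq_of_inner_eq_zero a (b - a) h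
  rw [add_sub_cancel] at h1
  nlinarith [norm_nonneg a, norm_nonneg b, mul_self_nonneg ‖b - a‖]

theorem IsGalerkin.norm_sub_le {Wh : Submodule ℝ (H × M)} {z w y : H × M}
    (hw : IsGalerkin Wh z w) (hy : y ∈ Wh) : ‖z.2 - w.2‖ ≤ ‖z.2 - y.2‖ := by
  refine norm_le_of_inner_sub_eq_zero ?_
  rw [sub_sub_sub_cancel_left]
  exact hw.2 (w - y) (Wh.sub_mem hw.1 hy)

/-- Prager–Synge: a tensor `p` in equilibrium with the load bounds the Galerkin error. -/
theorem IsGalerkin.norm_sub_le_of_equilibrium {W Wh : Submodule ℝ (H × M)} (hWh : Wh ≤ W)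
    {f : H} {z w y : H × M} {p : M} (hz : IsVarSol W f z) (hw : IsGalerkin Wh z w) (hy : y ∈ Wh)
    (hp : ∀ v ∈ W, inner ℝ p v.2 = inner ℝ f v.1) : ‖z.2 - w.2‖ ≤ ‖p - y.2‖ := by
  -- By Pythagoras it suffices that `p - z.2` is orthogonal to `z.2 - y.2`. Since `z - y` lies in
  -- `W`, both `p` and `z.2` pair with its gradient as the load does.
  refine (hw.norm_sub_le hy).trans (norm_le_of_inner_sub_eq_zero ?_)
  have hmem := W.sub_mem hz.1 (hWh hy)
  rw [sub_sub_sub_cancel_right, real_inner_comm, inner_sub_left]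
  exact sub_eq_zero.2 ((hp _ hmem).trans (hz.2 _ hmem).symm)

theorem IsGalerkin.norm_sub_le_of_projection {W Wh : Submodule ℝ (H × M)}
    [FiniteDimensional ℝ Wh] {X : Submodule ℝ H} [X.HasOrthogonalProjection] {κ c : ℝ} (hc0 : 0 ≤ c)
    (hsol : ∀ g, ∃ z, IsVarSol W g z)
    (hκ : ∀ g ∈ X, ∀ z w, IsVarSol W g z → IsGalerkin Wh z w → ‖z.2 - w.2‖ ≤ κ * ‖g‖)
    (hc : ∀ w ∈ W, ‖w.1 - X.starProjection w.1‖ ≤ c * ‖w.2‖)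
    {f : H} {z w : H × M} (hz : IsVarSol W f z) (hw : IsGalerkin Wh z w) :
    ‖z.2 - w.2‖ ≤ √(κ ^ 2 + c ^ 2) * ‖f‖ := by
  set π := X.starProjection
  obtain ⟨z', hz'⟩ := hsol (π f)
  obtain ⟨w', hw'⟩ := exists_isGalerkin Wh z'
  have h1 := hκ _ (X.starProjection_apply_mem f) z' w' hz' hw'
  -- The difference e of the solutions has load `f - π f`, which is orthogonal to `X`; so ‖∇e‖² = (f
  -- - πf, e - πe), and one factor ‖∇e‖ cancels.
  have h2 : ‖z.2 - z'.2‖ ≤ c * ‖f - π f‖ := by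
    have hd := hz.sub hz'
    have ha : ‖z.2 - z'.2‖ ^ 2 = inner ℝ (f - π f) ((z - z').1 - π (z - z').1) := by
      rw [inner_sub_right, X.starProjection_inner_eq_zero f _ (X.starProjection_apply_mem _),
        sub_zero, ← hd.2 _ hd.1, real_inner_self_eq_norm_sq]
      rfl
    have hb := real_inner_le_norm (f - π f) ((z - z').1 - π (z - z').1)
    have hc' := mul_le_mul_of_nonneg_left (hc _ hd.1) (norm_nonneg (f - π f))
    rw [← ha] at hb
    rw [Prod.snd_sub] at hc'
    rcases (norm_nonneg (z.2 - z'.2)).eq_or_lt with h0 | h0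
    · rw [← h0]; positivity
    · exact le_of_mul_le_mul_right (by nlinarith) h0
  have h3 : ‖f‖ ^ 2 = ‖π f‖ ^ 2 + ‖f - π f‖ ^ 2 := by
    have := norm_add_sq_eq_norm_sq_add_norm_sq_of_inner_eq_zero (f - π f) (π f)
      (X.starProjection_inner_eq_zero f _ (X.starProjection_apply_mem f))
    rw [sub_add_cancel] at this
    nlinarith
  -- By best approximation, `w'`, the Galerkin projection for the load `π f`, is a competitor for
  -- `w`.
  have h4 : ‖z.2 - w.2‖ ≤ κ * ‖π f‖ + c * ‖f - π f‖ := by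
    have h5 := norm_sub_le_norm_sub_add_norm_sub z.2 z'.2 w'.2
    linarith [hw.norm_sub_le hw'.1]
  refine h4.trans (abs_le_of_sq_le_sq' ?_ (by positivity)).2
  rw [mul_pow, Real.sq_sqrt (by positivity), h3]
  -- Lagrange's identity: (κa + cb)² + (κb - ca)² = (κ² + c²)(a² + b²).
  nlinarith [sq_nonneg (κ * ‖f - π f‖ - c * ‖π f‖)]

/-- The Aubin–Nitsche duality argument. -/
theorem IsGalerkin.norm_fst_sub_le {W Wh : Submodule ℝ (H × M)} (hWh : Wh ≤ W)
    [FiniteDimensional ℝ Wh] {C : ℝ}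
    (hsol : ∀ g, ∃ z, IsVarSol W g z)
    (hC : ∀ g z w, IsVarSol W g z → IsGalerkin Wh z w → ‖z.2 - w.2‖ ≤ C * ‖g‖)
    {z w : H × M} (hz : z ∈ W) (hw : IsGalerkin Wh z w) (hpos : 0 ≤ C) :
    ‖z.1 - w.1‖ ≤ C * ‖z.2 - w.2‖ := by
  obtain ⟨y, hy⟩ := hsol (z.1 - w.1)
  obtain ⟨v, hv⟩ := exists_isGalerkin Wh y
  -- `y` solves the dual problem; `v` may be subtracted because the Galerkin error is orthogonal to
  -- `Wh`.
  have h1 : ‖z.1 - w.1‖ ^ 2 = inner ℝ (y.2 - v.2) (z.2 - w.2) := by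
    rw [inner_sub_left, real_inner_comm _ v.2, hw.2 v hv.1, sub_zero,
      ← real_inner_self_eq_norm_sq]
    exact (hy.2 _ (W.sub_mem hz (hWh hw.1))).symm
  have h2 := real_inner_le_norm (y.2 - v.2) (z.2 - w.2)
  have h3 := mul_le_mul_of_nonneg_right (hC _ y v hy hv) (norm_nonneg (z.2 - w.2))
  rcases (norm_nonneg (z.1 - w.1)).eq_or_lt with h0 | h0
  · rw [← h0]; positivity
  · exact le_of_mul_le_mul_right (by nlinarith) h0

end Abstract

/-! ### Components of L² fields -/

section Coordinates

variable {α ι : Type*} [MeasurableSpace α] {μ : Measure α} [Fintype ι]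

/-- The `i`-th component of an `L²` field. -/
noncomputable def coord (i : ι) : Lp (EuclideanSpace ℝ ι) 2 μ →L[ℝ] Lp ℝ 2 μ :=
  (EuclideanSpace.proj i : EuclideanSpace ℝ ι →L[ℝ] ℝ).compLpL 2 μ

theorem coeFn_coord (i : ι) (u : Lp (EuclideanSpace ℝ ι) 2 μ) :
    coord i u =ᵐ[μ] fun x => u x i :=
  ContinuousLinearMap.coeFn_compLpL _ _

theorem inner_eq_sum_coord (u v : Lp (EuclideanSpace ℝ ι) 2 μ) :
    inner ℝ u v = ∑ i, inner ℝ (coord i u) (coord i v) := by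
  simp_rw [L2.inner_def]
  rw [← integral_finsetSum _ fun i _ => L2.integrable_inner (coord i u) (coord i v)]
  refine integral_congr_ae ?_
  have hu := ae_all_iff.2 fun i => coeFn_coord i u
  have hv := ae_all_iff.2 fun i => coeFn_coord i v
  filter_upwards [hu, hv] with x h1 h2
  simp [PiLp.inner_apply, h1, h2]

theorem norm_sq_eq_sum_coord (u : Lp (EuclideanSpace ℝ ι) 2 μ) :
    ‖u‖ ^ 2 = ∑ i, ‖coord i u‖ ^ 2 := by
  simp_rw [← real_inner_self_eq_norm_sq]
  exact inner_eq_sum_coord u u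

theorem norm_coord_le (i : ι) (u : Lp (EuclideanSpace ℝ ι) 2 μ) : ‖coord i u‖ ≤ ‖u‖ := by
  refine (abs_le_of_sq_le_sq' ?_ (norm_nonneg u)).2
  rw [norm_sq_eq_sum_coord u]
  exact Finset.single_le_sum (f := fun i => ‖coord i u‖ ^ 2) (fun _ _ => sq_nonneg _)
    (Finset.mem_univ i)

theorem norm_le_sum_coord (u : Lp (EuclideanSpace ℝ ι) 2 μ) : ‖u‖ ≤ ∑ i, ‖coord i u‖ := by
  refine (abs_le_of_sq_le_sq' ?_ (Finset.sum_nonneg fun _ _ => norm_nonneg _)).2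
  rw [norm_sq_eq_sum_coord u]
  exact Finset.sum_sq_le_sq_sum_of_nonneg fun _ _ => norm_nonneg _

theorem tendsto_of_coord {u : ℕ → Lp (EuclideanSpace ℝ ι) 2 μ} {v : Lp (EuclideanSpace ℝ ι) 2 μ}
    (h : ∀ i, Tendsto (fun n => coord i (u n)) atTop (𝓝 (coord i v))) :
    Tendsto u atTop (𝓝 v) := by
  rw [tendsto_iff_norm_sub_tendsto_zero]
  have h1 : Tendsto (fun n => ∑ i, ‖coord i (u n - v)‖) atTop (𝓝 0) := by
    simp_rw [map_sub]
    simpa using tendsto_finsetSum (Finset.univ : Finset ι) fun i _ =>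
      tendsto_iff_norm_sub_tendsto_zero.1 (h i)
  exact squeeze_zero (fun _ => norm_nonneg _) (fun n => norm_le_sum_coord _) h1

theorem ext_coord {u v : Lp (EuclideanSpace ℝ ι) 2 μ} (h : ∀ i, coord i u = coord i v) :
    u = v := by
  rw [← sub_eq_zero, ← norm_le_zero_iff]
  refine (norm_le_sum_coord _).trans (Finset.sum_nonpos fun i _ => ?_)
  rw [map_sub, h i, sub_self, norm_zero]

/-- The `L²` field with given components. -/
theorem exists_coord_eq (g : ι → Lp ℝ 2 μ) :
    ∃ u : Lp (EuclideanSpace ℝ ι) 2 μ, ∀ i, coord i u = g i := by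
  have hm : MemLp (fun x => WithLp.toLp 2 fun i => g i x : α → EuclideanSpace ℝ ι) 2 μ :=
    MemLp.of_eval_piLp fun i => Lp.memLp (g i)
  refine ⟨hm.toLp _, fun i => Lp.ext ?_⟩
  filter_upwards [coeFn_coord i (hm.toLp _), hm.coeFn_toLp] with x h1 h2
  rw [h1, h2]

end Coordinates

/-! ### Test functions in L² -/

section Test

variable {Ω : Set E3}

theorem IsTest.zero : IsTest Ω 0 :=
  ⟨contDiff_const, HasCompactSupport.zero, by simp [tsupport]⟩

theorem IsTest.add {φ ψ : E3 → ℝ} (hφ : IsTest Ω φ) (hψ : IsTest Ω ψ) : IsTest Ω (φ + ψ) :=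
  ⟨hφ.1.add hψ.1, hφ.2.1.add hψ.2.1,
    (tsupport_add φ ψ).trans (Set.union_subset hφ.2.2 hψ.2.2)⟩

theorem IsTest.smul {φ : E3 → ℝ} (hφ : IsTest Ω φ) (c : ℝ) : IsTest Ω (c • φ) :=
  ⟨contDiff_const.smul hφ.1, hφ.2.1.smul_left (f := fun _ => c),
    (tsupport_smul_subset_right (fun _ => c) φ).trans hφ.2.2⟩

theorem IsTest.pderiv {φ : E3 → ℝ} (hφ : IsTest Ω φ) (j : Fin 3) : IsTest Ω (pderiv j φ) :=
  ⟨(hφ.1.fderiv_right (m := ∞) le_rfl).clm_apply contDiff_const,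
    hφ.2.1.fderiv_apply ℝ _,
    (tsupport_fderiv_apply_subset ℝ _).trans hφ.2.2⟩

theorem IsTest.memLp {φ : E3 → ℝ} (hφ : IsTest Ω φ) : MemLp φ 2 (volume.restrict Ω) :=
  hφ.1.continuous.memLp_of_hasCompactSupport hφ.2.1

theorem pderiv_zero (j : Fin 3) : pderiv j 0 = 0 := by
  ext x
  simp [pderiv]

theorem pderiv_add {φ ψ : E3 → ℝ} (hφ : IsTest Ω φ) (hψ : IsTest Ω ψ) (j : Fin 3) :
    pderiv j (φ + ψ) = pderiv j φ + pderiv j ψ := by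
  ext x
  simp only [Stokes.pderiv, Pi.add_apply]
  rw [fderiv_add (hφ.1.differentiable (by simp) x) (hψ.1.differentiable (by simp) x)]
  rfl

theorem pderiv_smul {φ : E3 → ℝ} (hφ : IsTest Ω φ) (c : ℝ) (j : Fin 3) :
    pderiv j (c • φ) = c • pderiv j φ := by
  ext x
  simp only [Stokes.pderiv, Pi.smul_apply]
  rw [fderiv_const_smul (hφ.1.differentiable (by simp) x)]
  rfl

/-- The class of a test function in `L²(Ω)`. -/
noncomputable def IsTest.toL2 {φ : E3 → ℝ} (hφ : IsTest Ω φ) : L2s Ω := hφ.memLp.toLp φ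

theorem IsTest.toL2_congr {φ ψ : E3 → ℝ} (hφ : IsTest Ω φ) (hψ : IsTest Ω ψ) (h : φ = ψ) :
    hφ.toL2 = hψ.toL2 := by
  subst h
  rfl

theorem IsTest.toL2_zero : (IsTest.zero : IsTest Ω 0).toL2 = 0 :=
  MemLp.toLp_zero _

theorem IsTest.toL2_add {φ ψ : E3 → ℝ} (hφ : IsTest Ω φ) (hψ : IsTest Ω ψ) :
    (hφ.add hψ).toL2 = hφ.toL2 + hψ.toL2 :=
  MemLp.toLp_add _ _

theorem IsTest.toL2_smul {φ : E3 → ℝ} (hφ : IsTest Ω φ) (c : ℝ) :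
    (hφ.smul c).toL2 = c • hφ.toL2 :=
  MemLp.toLp_const_smul c _

theorem IsTest.inner_toL2 {φ : E3 → ℝ} (hφ : IsTest Ω φ) {v : L2s Ω} {w : E3 → ℝ}
    (hw : v =ᵐ[volume.restrict Ω] w) :
    inner ℝ v hφ.toL2 = ∫ x in Ω, w x * φ x := by
  rw [L2.inner_def]
  refine integral_congr_ae ?_
  filter_upwards [hw, hφ.memLp.coeFn_toLp] with x h1 h2
  rw [IsTest.toL2, h1, h2]
  simp [mul_comm]

/-- The Sobolev inequality for functions supported in a bounded set, with both exponents 2; the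
operator norm of the derivative is at most the sum of the moduli of the partial derivatives. -/
theorem exists_norm_toL2_le (hb : Bornology.IsBounded Ω) :
    ∃ C : ℝ, 0 ≤ C ∧ ∀ (φ : E3 → ℝ) (hφ : IsTest Ω φ),
      ‖hφ.toL2‖ ≤ C * ∑ j, ‖(hφ.pderiv j).toL2‖ := by
  let C := eLpNormLESNormFDerivOfLeConst ℝ (volume : Measure E3) Ω 2 2
  refine ⟨C, C.2, fun φ hφ => ?_⟩
  have h1 : eLpNorm φ 2 volume ≤ C * eLpNorm (fderiv ℝ φ) 2 volume :=
    eLpNorm_le_eLpNorm_fderiv volume (hφ.1.of_le (by simp))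
      ((subset_tsupport φ).trans hφ.2.2) (p := 2) (by norm_num) (by simp; norm_num) hb
  have h2 : eLpNorm (fderiv ℝ φ) 2 volume ≤ eLpNorm (∑ j, fun x => ‖pderiv j φ x‖) 2 volume := by
    refine eLpNorm_mono_real fun x => ?_
    rw [Finset.sum_apply]
    refine ContinuousLinearMap.opNorm_le_bound _ (Finset.sum_nonneg fun _ _ => norm_nonneg _)
      fun y => ?_
    have hy : y = ∑ j, y j • EuclideanSpace.single j (1 : ℝ) := by
      ext i
      simp [Finset.sum_apply, Pi.single_apply]
    conv_lhs => rw [hy]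
    rw [map_sum, Finset.sum_mul]
    refine (norm_sum_le _ _).trans (Finset.sum_le_sum fun j _ => ?_)
    rw [map_smul, norm_smul, mul_comm]
    exact mul_le_mul_of_nonneg_left (PiLp.norm_apply_le y j) (norm_nonneg _)
  have h3 : eLpNorm (∑ j, fun x => ‖pderiv j φ x‖) 2 volume
      ≤ ∑ j, eLpNorm (pderiv j φ) 2 volume := by
    refine (eLpNorm_sum_le (fun j _ => ?_) (by norm_num)).trans
      (Finset.sum_le_sum fun j _ => (eLpNorm_norm _).le)
    exact (hφ.pderiv j).1.continuous.norm.aestronglyMeasurable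
  have key : ∀ (ψ : E3 → ℝ) (hψ : IsTest Ω ψ), eLpNorm ψ 2 volume = ‖hψ.toL2‖ₑ := by
    intro ψ hψ
    rw [IsTest.toL2, Lp.enorm_toLp,
      eLpNorm_restrict_eq_of_support_subset ((subset_tsupport ψ).trans hψ.2.2)]
  have h4 := h1.trans (mul_le_mul_right (h2.trans h3) _)
  simp_rw [fun j => key _ (hφ.pderiv j), key _ hφ] at h4
  rw [← ofReal_norm, ← ENNReal.ofReal_coe_nnreal] at h4
  simp_rw [← ofReal_norm] at h4
  rw [← ENNReal.ofReal_sum_of_nonneg fun _ _ => norm_nonneg _,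
    ← ENNReal.ofReal_mul C.coe_nonneg] at h4
  exact (ENNReal.ofReal_le_ofReal_iff
    (mul_nonneg C.2 (Finset.sum_nonneg fun _ _ => norm_nonneg _))).1 h4

/-- The fundamental lemma of the calculus of variations. It makes weak gradients unique, and is
where openness of `Ω` enters. -/
theorem eq_zero_of_inner_toL2 (hΩ : IsOpen Ω) {v : L2s Ω}
    (h : ∀ (φ : E3 → ℝ) (hφ : IsTest Ω φ), inner ℝ v hφ.toL2 = 0) : v = 0 := by
  apply Lp.ext
  have hloc : LocallyIntegrableOn v Ω volume := by
    have := (Lp.memLp v).locallyIntegrable (by norm_num)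
    exact (locallyIntegrableOn_of_locallyIntegrable_restrict this)
  have h1 := hΩ.ae_eq_zero_of_integral_contDiff_smul_eq_zero hloc fun g hg hgc hgs => by
    have hg : IsTest Ω g := ⟨hg, hgc, hgs⟩
    have h2 := h g hg
    rw [hg.inner_toL2 ae_eq_rfl] at h2
    rw [← h2, ← setIntegral_eq_integral_of_forall_compl_eq_zero (s := Ω)]
    · simp [mul_comm]
    · intro x hx
      rw [image_eq_zero_of_notMem_tsupport fun hx' => hx (hgs hx'), zero_smul]
  rw [← ae_restrict_iff' hΩ.measurableSet] at h1
  filter_upwards [h1, Lp.coeFn_zero ℝ 2 (volume.restrict Ω)] with x h2 h3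
  rw [h2, h3]; rfl

end Test

/-! ### The graph of the gradient and integration by parts -/

section Graph

variable {Ω : Set E3}

/-- As inner products, weak identities become equations between continuous functionals on L², hence
closed conditions. -/
theorem hasWeakDiv_iff {w : E3 → Fin 3 → ℝ} {g : E3 → ℝ} {a : Fin 3 → L2s Ω} {b : L2s Ω}
    (ha : ∀ j, a j =ᵐ[volume.restrict Ω] fun x => w x j) (hb : b =ᵐ[volume.restrict Ω] g) :
    HasWeakDiv Ω w g ↔ ∀ (φ : E3 → ℝ) (hφ : IsTest Ω φ),
      ∑ j, inner ℝ (a j) (hφ.pderiv j).toL2 = - inner ℝ b hφ.toL2 := by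
  refine forall₂_congr fun φ hφ => ?_
  rw [hφ.inner_toL2 hb, integral_finsetSum]
  · simp_rw [fun j => (hφ.pderiv j).inner_toL2 (ha j)]
  · intro j _
    refine (L2.integrable_inner (𝕜 := ℝ) (a j) (hφ.pderiv j).toL2).congr ?_
    filter_upwards [ha j, (hφ.pderiv j).memLp.coeFn_toLp] with x h1 h2
    rw [IsTest.toL2, h1, h2]
    simp [mul_comm]

theorem hasWeakPartial_iff {j : Fin 3} {u g : E3 → ℝ} {a b : L2s Ω}
    (ha : a =ᵐ[volume.restrict Ω] u) (hb : b =ᵐ[volume.restrict Ω] g) :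
    HasWeakPartial Ω j u g ↔ ∀ (φ : E3 → ℝ) (hφ : IsTest Ω φ),
      inner ℝ a (hφ.pderiv j).toL2 = - inner ℝ b hφ.toL2 := by
  refine forall₂_congr fun φ hφ => ?_
  rw [hφ.inner_toL2 hb, (hφ.pderiv j).inner_toL2 ha]

theorem hasGradV_iff {u : L2v Ω} {G : L2m Ω} :
    HasGradV u G ↔ ∀ (i j : Fin 3) (φ : E3 → ℝ) (hφ : IsTest Ω φ),
      inner ℝ (coord i u) (hφ.pderiv j).toL2 = - inner ℝ (coord (i, j) G) hφ.toL2 :=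
  forall₂_congr fun i j => hasWeakPartial_iff (coeFn_coord i u) (coeFn_coord (i, j) G)

theorem hasGrad_iff {u : L2s Ω} {g : L2v Ω} :
    HasGrad u g ↔ ∀ (j : Fin 3) (φ : E3 → ℝ) (hφ : IsTest Ω φ),
      inner ℝ u (hφ.pderiv j).toL2 = - inner ℝ (coord j g) hφ.toL2 :=
  forall_congr' fun j => hasWeakPartial_iff ae_eq_rfl (coeFn_coord j g)

theorem hasDivM_iff {p : L2m Ω} {g : L2v Ω} :
    HasDivM p g ↔ ∀ (i : Fin 3) (φ : E3 → ℝ) (hφ : IsTest Ω φ),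
      ∑ j, inner ℝ (coord (i, j) p) (hφ.pderiv j).toL2 = - inner ℝ (coord i g) hφ.toL2 :=
  forall_congr' fun i => hasWeakDiv_iff (fun j => coeFn_coord (i, j) p) (coeFn_coord i g)

theorem hasWeakDiv_zero_iff {v : L2v Ω} :
    HasWeakDiv Ω (fun x j => v x j) 0 ↔ ∀ (φ : E3 → ℝ) (hφ : IsTest Ω φ),
      ∑ j, inner ℝ (coord j v) (hφ.pderiv j).toL2 = 0 := by
  rw [hasWeakDiv_iff (fun j => coeFn_coord j v) (Lp.coeFn_zero ℝ 2 (volume.restrict Ω))]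
  simp

theorem HasGradV.unique (hΩ : IsOpen Ω) {u : L2v Ω} {G G' : L2m Ω} (h : HasGradV u G)
    (h' : HasGradV u G') : G = G' := by
  refine ext_coord fun ij => sub_eq_zero.1 (eq_zero_of_inner_toL2 hΩ fun φ hφ => ?_)
  have h1 := hasGradV_iff.1 h ij.1 ij.2 φ hφ
  rw [hasGradV_iff.1 h' ij.1 ij.2 φ hφ] at h1
  rw [inner_sub_left]
  linarith

theorem gradV_eq (hΩ : IsOpen Ω) {u : L2v Ω} {G : L2m Ω} (h : HasGradV u G) : gradV u = G := by
  have hex : ∃ G : L2m Ω, HasGradV u G := ⟨G, h⟩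
  rw [gradV, dif_pos hex]
  exact hex.choose_spec.unique hΩ h

/-- The pairs `(φ, ∇φ)` with `φ` a vector field of test functions. -/
def testGraph (Ω : Set E3) : Submodule ℝ (L2v Ω × L2m Ω) where
  carrier := {z | ∃ (φ : Fin 3 → E3 → ℝ) (hφ : ∀ i, IsTest Ω (φ i)),
    (∀ i, coord i z.1 = (hφ i).toL2) ∧ ∀ i j, coord (i, j) z.2 = ((hφ i).pderiv j).toL2}
  zero_mem' := by
    refine ⟨fun _ => 0, fun _ => IsTest.zero, fun i => ?_, fun i j => ?_⟩
    · rw [IsTest.toL2_zero]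
      exact map_zero (coord i)
    · rw [(IsTest.zero.pderiv j).toL2_congr IsTest.zero (pderiv_zero j), IsTest.toL2_zero]
      exact map_zero (coord (i, j))
  add_mem' := by
    rintro y z ⟨φ, hφ, h1, h2⟩ ⟨ψ, hψ, h3, h4⟩
    refine ⟨fun i => φ i + ψ i, fun i => (hφ i).add (hψ i), fun i => ?_, fun i j => ?_⟩
    · rw [IsTest.toL2_add (hφ i) (hψ i), ← h1, ← h3]
      exact map_add (coord i) _ _
    · rw [(((hφ i).add (hψ i)).pderiv j).toL2_congr (((hφ i).pderiv j).add ((hψ i).pderiv j))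
        (pderiv_add (hφ i) (hψ i) j),
        IsTest.toL2_add ((hφ i).pderiv j) ((hψ i).pderiv j), ← h2, ← h4]
      exact map_add (coord (i, j)) _ _
  smul_mem' := by
    rintro c y ⟨φ, hφ, h1, h2⟩
    refine ⟨fun i => c • φ i, fun i => (hφ i).smul c, fun i => ?_, fun i j => ?_⟩
    · rw [IsTest.toL2_smul (hφ i), ← h1]
      exact map_smul (coord i) c _
    · rw [(((hφ i).smul c).pderiv j).toL2_congr (((hφ i).pderiv j).smul c)
        (pderiv_smul (hφ i) c j), IsTest.toL2_smul ((hφ i).pderiv j), ← h2]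
      exact map_smul (coord (i, j)) c _

theorem enorm_coord_sub_toL2 {ι : Type*} [Fintype ι] (i : ι)
    (u : Lp (EuclideanSpace ℝ ι) 2 (volume.restrict Ω)) {φ : E3 → ℝ} (hφ : IsTest Ω φ) :
    ‖coord i u - hφ.toL2‖ₑ = eLpNorm (fun x => u x i - φ x) 2 (volume.restrict Ω) := by
  rw [Lp.enorm_def]
  refine eLpNorm_congr_ae ?_
  filter_upwards [Lp.coeFn_sub (coord i u) hφ.toL2, coeFn_coord i u, hφ.memLp.coeFn_toLp]
    with x h1 h2 h3
  rw [h1, Pi.sub_apply, h2, IsTest.toL2, h3]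

theorem tendsto_toL2_iff {ι : Type*} [Fintype ι] (i : ι)
    (u : Lp (EuclideanSpace ℝ ι) 2 (volume.restrict Ω)) {φ : ℕ → E3 → ℝ}
    (hφ : ∀ n, IsTest Ω (φ n)) :
    Tendsto (fun n => (hφ n).toL2) atTop (𝓝 (coord i u)) ↔
      Tendsto (fun n => eLpNorm (fun x => u x i - φ n x) 2 (volume.restrict Ω)) atTop (𝓝 0) := by
  rw [tendsto_iff_edist_tendsto_0]
  simp_rw [edist_comm _ (coord i u), edist_eq_enorm_sub, fun n => enorm_coord_sub_toL2 i u (hφ n)]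

/-- Componentwise convergence of the fields and their derivatives is convergence of the pairs in L²
× L², where closure is sequential. -/
theorem mem_H10_iff {u : L2v Ω} :
    u ∈ H10 Ω ↔ ∃ G : L2m Ω, HasGradV u G ∧ (u, G) ∈ (testGraph Ω).topologicalClosure := by
  refine exists_congr fun G => and_congr_right fun _ => ?_
  rw [← SetLike.mem_coe, Submodule.topologicalClosure_coe]
  constructor
  · rintro ⟨φ, hφ, h1, h2⟩
    choose a ha using fun n => exists_coord_eq fun i => (hφ n i).toL2
    choose b hb using fun n => exists_coord_eq fun ij : Fin 3 × Fin 3 =>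
      ((hφ n ij.1).pderiv ij.2).toL2
    refine mem_closure_of_tendsto (f := fun n => (a n, b n)) (b := atTop)
      (Tendsto.prodMk_nhds (tendsto_of_coord fun i => ?_) (tendsto_of_coord fun ij => ?_))
      (Eventually.of_forall fun n => ⟨φ n, hφ n, ha n, fun i j => hb n (i, j)⟩)
    · simp_rw [ha]
      exact (tendsto_toL2_iff i u fun n => hφ n i).2 (h1 i)
    · simp_rw [hb]
      exact (tendsto_toL2_iff ij G fun n => (hφ n ij.1).pderiv ij.2).2 (h2 ij.1 ij.2)
  · intro h
    obtain ⟨z, hz, hlim⟩ := mem_closure_iff_seq_limit.1 h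
    choose φ hφ h1 h2 using hz
    refine ⟨φ, hφ, fun i => ?_, fun i j => ?_⟩
    · rw [← tendsto_toL2_iff i u fun n => hφ n i]
      simp_rw [← h1]
      exact ((coord i).continuous.comp continuous_fst).continuousAt.tendsto.comp hlim
    · rw [← tendsto_toL2_iff (i, j) G fun n => (hφ n i).pderiv j]
      simp_rw [← h2]
      exact ((coord (i, j)).continuous.comp continuous_snd).continuousAt.tendsto.comp hlim

/-- `(u, G) ↦ (u_i, ∂_jφ) + (G_ij, φ)`, which vanishes for all `φ` iff `G_ij = ∂_j u_i`. -/
noncomputable def gradDefect (i j : Fin 3) {φ : E3 → ℝ} (hφ : IsTest Ω φ) :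
    L2v Ω × L2m Ω →L[ℝ] ℝ :=
  (innerSL ℝ (hφ.pderiv j).toL2 ∘L coord i) ∘L ContinuousLinearMap.fst ℝ (L2v Ω) (L2m Ω) +
    (innerSL ℝ hφ.toL2 ∘L coord (i, j)) ∘L ContinuousLinearMap.snd ℝ (L2v Ω) (L2m Ω)

/-- `(u, G) ↦ (u, ∇φ)`, which vanishes for all `φ` iff `div u = 0`. -/
noncomputable def divDefect {φ : E3 → ℝ} (hφ : IsTest Ω φ) : L2v Ω × L2m Ω →L[ℝ] ℝ :=
  (∑ j, innerSL ℝ (hφ.pderiv j).toL2 ∘L coord j) ∘L ContinuousLinearMap.fst ℝ (L2v Ω) (L2m Ω)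

/-- The graph of the gradient on `V`. -/
noncomputable def graphV (Ω : Set E3) : Submodule ℝ (L2v Ω × L2m Ω) :=
  (testGraph Ω).topologicalClosure ⊓
    ((⨅ (i : Fin 3) (j : Fin 3) (φ : {φ // IsTest Ω φ}),
      LinearMap.ker (gradDefect i j φ.2 : L2v Ω × L2m Ω →ₗ[ℝ] ℝ)) ⊓
    ⨅ φ : {φ // IsTest Ω φ}, LinearMap.ker (divDefect φ.2 : L2v Ω × L2m Ω →ₗ[ℝ] ℝ))

theorem mem_graphV {z : L2v Ω × L2m Ω} :
    z ∈ graphV Ω ↔ z ∈ (testGraph Ω).topologicalClosure ∧ HasGradV z.1 z.2 ∧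
      HasWeakDiv Ω (fun x j => z.1 x j) 0 := by
  rw [graphV, Submodule.mem_inf, Submodule.mem_inf, hasGradV_iff, hasWeakDiv_zero_iff]
  simp only [Submodule.mem_iInf, LinearMap.mem_ker, Subtype.forall]
  refine and_congr_right fun _ => and_congr ?_ ?_
  · refine forall₂_congr fun i j => forall₂_congr fun φ hφ => ?_
    rw [eq_neg_iff_add_eq_zero, real_inner_comm, real_inner_comm hφ.toL2]
    rfl
  · refine forall₂_congr fun φ hφ => ?_
    have : divDefect hφ z = ∑ j, inner ℝ (coord j z.1) (hφ.pderiv j).toL2 := by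
      simp [divDefect, real_inner_comm]
    rw [← this]
    rfl

theorem isClosed_graphV : IsClosed (graphV Ω : Set (L2v Ω × L2m Ω)) := by
  rw [graphV]
  simp only [Submodule.coe_inf, Submodule.coe_iInf]
  refine (Submodule.isClosed_topologicalClosure _).inter (IsClosed.inter ?_ ?_)
  · exact isClosed_iInter fun i => isClosed_iInter fun j => isClosed_iInter fun φ =>
      (gradDefect i j φ.2).isClosed_ker
  · exact isClosed_iInter fun φ => (divDefect φ.2).isClosed_ker

theorem gradV_fst (hΩ : IsOpen Ω) {z : L2v Ω × L2m Ω} (hz : z ∈ graphV Ω) : gradV z.1 = z.2 :=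
  gradV_eq hΩ (mem_graphV.1 hz).2.1

theorem fst_mem_V {z : L2v Ω × L2m Ω} (hz : z ∈ graphV Ω) : z.1 ∈ V Ω :=
  have h := mem_graphV.1 hz
  ⟨mem_H10_iff.2 ⟨z.2, h.2.1, h.1⟩, h.2.2⟩

theorem mem_graphV_of_mem_V (hΩ : IsOpen Ω) {u : L2v Ω} (hu : u ∈ V Ω) :
    (u, gradV u) ∈ graphV Ω := by
  obtain ⟨G, hG, hcl⟩ := mem_H10_iff.1 hu.1
  rw [gradV_eq hΩ hG]
  exact mem_graphV.2 ⟨hcl, hG, hu.2⟩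

theorem forall_mem_closure_testGraph {p : L2v Ω × L2m Ω → Prop} (hp : IsClosed {z | p z})
    (h : ∀ z ∈ testGraph Ω, p z) : ∀ z ∈ (testGraph Ω).topologicalClosure, p z :=
  fun _ hz => closure_minimal (show (testGraph Ω : Set _) ⊆ {z | p z} from h) hp hz

/-- The Poincaré inequality. -/
theorem exists_norm_fst_le (hb : Bornology.IsBounded Ω) :
    ∃ C : ℝ, ∀ z ∈ graphV Ω, ‖z.1‖ ≤ C * ‖z.2‖ := by
  obtain ⟨C, hC, hφC⟩ := exists_norm_toL2_le hb
  -- The constant is 9C: three components, each with three partial derivatives bounded by the full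
  -- gradient. The inequality is closed, so test fields suffice.
  refine ⟨∑ _ : Fin 3, C * ∑ _ : Fin 3, 1, fun z hz => forall_mem_closure_testGraph
    (p := fun z => ‖z.1‖ ≤ (∑ _ : Fin 3, C * ∑ _ : Fin 3, 1) * ‖z.2‖)
    (isClosed_le (by fun_prop) (by fun_prop)) ?_ z (mem_graphV.1 hz).1⟩
  rintro y ⟨φ, hφ, h1, h2⟩
  refine (norm_le_sum_coord y.1).trans ?_
  rw [Finset.sum_mul]
  refine Finset.sum_le_sum fun i _ => ?_
  rw [h1, mul_assoc, Finset.sum_mul]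
  refine (hφC _ (hφ i)).trans (mul_le_mul_of_nonneg_left (Finset.sum_le_sum fun j _ => ?_) hC)
  rw [← h2, one_mul]
  exact norm_coord_le _ _

theorem sum_coord_diag_eq_zero (hΩ : IsOpen Ω) {z : L2v Ω × L2m Ω} (hz : z ∈ graphV Ω) :
    ∑ j : Fin 3, coord (j, j) z.2 = 0 := by
  obtain ⟨-, hG, hdiv⟩ := mem_graphV.1 hz
  refine eq_zero_of_inner_toL2 hΩ fun φ hφ => ?_
  have h1 := hasWeakDiv_zero_iff.1 hdiv φ hφ
  simp_rw [fun j => hasGradV_iff.1 hG j j φ hφ, Finset.sum_neg_distrib] at h1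
  rw [sum_inner]
  exact neg_eq_zero.1 h1

/-- For test fields this is the definition of the weak divergence; both sides are continuous, so it
extends to the closure, without boundary terms. -/
theorem inner_snd_of_hasDivM {p : L2m Ω} {D : L2v Ω} (hp : HasDivM p D) :
    ∀ z ∈ (testGraph Ω).topologicalClosure, inner ℝ p z.2 = - inner ℝ D z.1 := by
  refine forall_mem_closure_testGraph (isClosed_eq (by fun_prop) (by fun_prop)) ?_
  rintro z ⟨φ, hφ, h1, h2⟩
  rw [inner_eq_sum_coord, inner_eq_sum_coord, Fintype.sum_prod_type, ← Finset.sum_neg_distrib]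
  simp_rw [h1, h2]
  exact Finset.sum_congr rfl fun i _ => hasDivM_iff.1 hp i _ (hφ i)

theorem inner_sum_diag_of_hasGrad {q : L2s Ω} {g : L2v Ω} (hq : HasGrad q g) :
    ∀ z ∈ (testGraph Ω).topologicalClosure,
      inner ℝ q (∑ j : Fin 3, coord (j, j) z.2) = - inner ℝ g z.1 := by
  refine forall_mem_closure_testGraph (isClosed_eq (by fun_prop) (by fun_prop)) ?_
  rintro z ⟨φ, hφ, h1, h2⟩
  rw [inner_eq_sum_coord g, inner_sum, ← Finset.sum_neg_distrib]
  simp_rw [h1, h2]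
  exact Finset.sum_congr rfl fun j _ => hasGrad_iff.1 hq j _ (hφ j)

/-- The pressure gradient pairs to minus (q, tr ∇v), and tr ∇v = div v = 0. So equilibrium modulo a
gradient is equilibrium against V. -/
theorem inner_snd_of_mem_admissible (hΩ : IsOpen Ω) {T : TetMesh Ω} {k m : ℕ} {f : L2v Ω}
    {p : L2m Ω} (hp : p ∈ admissible T k m f) {z : L2v Ω × L2m Ω} (hz : z ∈ graphV Ω) :
    inner ℝ p z.2 = inner ℝ f z.1 := by
  obtain ⟨-, q, -, g, D, hq, hD, h0⟩ := hp
  have hcl := (mem_graphV.1 hz).1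
  have h1 := inner_sum_diag_of_hasGrad hq z hcl
  rw [sum_coord_diag_eq_zero hΩ hz, inner_zero_right] at h1
  have h2 : inner ℝ (D + g + f) z.1 = (0 : ℝ) := by rw [h0, inner_zero_left]
  rw [inner_add_left, inner_add_left] at h2
  rw [inner_snd_of_hasDivM hD z hcl]
  linarith

end Graph

/-! ### Finite element spaces and the constants -/

section Discrete

variable {Ω : Set E3}

theorem TetMesh.isBounded (T : TetMesh Ω) : Bornology.IsBounded Ω := by
  refine Bornology.IsBounded.subset ?_ (subset_closure.trans T.cover.ge)
  rw [Bornology.isBounded_biUnion_finset]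
  exact fun K _ => isBounded_convexHull.2 K.finite_toSet.isBounded

/-- The graph of the gradient on `V_h`. -/
noncomputable def graphVh (S : TetMesh Ω) (k : ℕ) : Submodule ℝ (L2v Ω × L2m Ω) :=
  graphV Ω ⊓ (Xh S k).comap (LinearMap.fst ℝ (L2v Ω) (L2m Ω))

theorem graphVh_le (S : TetMesh Ω) (k : ℕ) : graphVh S k ≤ graphV Ω := inf_le_left

theorem fst_mem_Vh {S : TetMesh Ω} {k : ℕ} {z : L2v Ω × L2m Ω} (hz : z ∈ graphVh S k) :
    z.1 ∈ Vh S k :=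
  ⟨fst_mem_V hz.1, hz.2⟩

theorem mem_graphVh_of_mem_Vh (hΩ : IsOpen Ω) {S : TetMesh Ω} {k : ℕ} {v : L2v Ω}
    (hv : v ∈ Vh S k) : (v, gradV v) ∈ graphVh S k :=
  ⟨mem_graphV_of_mem_V hΩ hv.1, hv.2⟩

/-- A pair is determined by its first component, so the graph embeds in `Xh S k`. -/
theorem finiteDimensional_graphVh (hΩ : IsOpen Ω) (S : TetMesh Ω) (k : ℕ) :
    FiniteDimensional ℝ (graphVh S k) := by
  let l : graphVh S k →ₗ[ℝ] Xh S k :=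
    ((LinearMap.fst ℝ (L2v Ω) (L2m Ω)).comp (graphVh S k).subtype).codRestrict (Xh S k)
      fun z => z.2.2
  refine FiniteDimensional.of_injective l fun y z h => Subtype.ext (Prod.ext ?_ ?_)
  · exact congrArg Subtype.val h
  · rw [← gradV_fst hΩ y.2.1, ← gradV_fst hΩ z.2.1]
    exact congrArg gradV (congrArg Subtype.val h)

theorem isStokesSolution_iff (hΩ : IsOpen Ω) {f u : L2v Ω} :
    IsStokesSolution f u ↔ IsVarSol (graphV Ω) f (u, gradV u) := by
  constructor
  · rintro ⟨hu, h⟩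
    refine ⟨mem_graphV_of_mem_V hΩ hu, fun w hw => ?_⟩
    rw [← gradV_fst hΩ hw]
    exact h _ (fst_mem_V hw)
  · rintro ⟨hu, h⟩
    exact ⟨fst_mem_V hu, fun v hv => h _ (mem_graphV_of_mem_V hΩ hv)⟩

theorem gradV_sub (hΩ : IsOpen Ω) {u v : L2v Ω} (hu : u ∈ V Ω) (hv : v ∈ V Ω) :
    gradV (u - v) = gradV u - gradV v :=
  gradV_fst hΩ ((graphV Ω).sub_mem (mem_graphV_of_mem_V hΩ hu) (mem_graphV_of_mem_V hΩ hv))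

theorem isPh_iff (hΩ : IsOpen Ω) {S : TetMesh Ω} {k : ℕ} {v w : L2v Ω} (hv : v ∈ V Ω) :
    IsPh S k v w ↔ IsGalerkin (graphVh S k) (v, gradV v) (w, gradV w) := by
  constructor
  · rintro ⟨hw, h⟩
    refine ⟨mem_graphVh_of_mem_Vh hΩ hw, fun y hy => ?_⟩
    have h1 := h _ (fst_mem_Vh hy)
    rwa [gradV_sub hΩ hv hw.1, gradV_fst hΩ hy.1] at h1
  · rintro ⟨hw, h⟩
    refine ⟨fst_mem_Vh hw, fun y hy => ?_⟩
    rw [gradV_sub hΩ hv (fst_mem_V hw.1)]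
    exact h _ (mem_graphVh_of_mem_Vh hΩ hy)

theorem fst_eq_of_snd_eq (hb : Bornology.IsBounded Ω) {y z : L2v Ω × L2m Ω}
    (hy : y ∈ graphV Ω) (hz : z ∈ graphV Ω) (h : y.2 = z.2) : y.1 = z.1 := by
  obtain ⟨C, hC⟩ := exists_norm_fst_le hb
  have h1 := hC _ ((graphV Ω).sub_mem hy hz)
  rw [Prod.snd_sub, h, sub_self, norm_zero, mul_zero, norm_le_zero_iff] at h1
  exact sub_eq_zero.1 h1

theorem existsUnique_isStokesSolution (hΩ : IsOpen Ω) (hb : Bornology.IsBounded Ω) (f : L2v Ω) :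
    ∃! u : L2v Ω, IsStokesSolution f u := by
  obtain ⟨C, hC⟩ := exists_norm_fst_le hb
  obtain ⟨z, hz⟩ := exists_isVarSol isClosed_graphV hC f
  refine ⟨z.1, ?_, fun u hu => ?_⟩
  · refine (isStokesSolution_iff hΩ).2 ?_
    rwa [gradV_fst hΩ hz.1]
  · have hu' := (isStokesSolution_iff hΩ).1 hu
    exact fst_eq_of_snd_eq hb hu'.1 hz.1 (hu'.snd_eq hz)

theorem existsUnique_isPh (hΩ : IsOpen Ω) (S : TetMesh Ω) (k : ℕ) {v : L2v Ω} (hv : v ∈ V Ω) :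
    ∃! w : L2v Ω, IsPh S k v w := by
  have := finiteDimensional_graphVh hΩ S k
  obtain ⟨w, hw⟩ := exists_isGalerkin (graphVh S k) (v, gradV v)
  refine ⟨w.1, ?_, fun y hy => ?_⟩
  · refine (isPh_iff hΩ hv).2 ?_
    rwa [gradV_fst hΩ hw.1.1]
  · have hy' := (isPh_iff hΩ hv).1 hy
    exact fst_eq_of_snd_eq S.isBounded hy'.1.1 hw.1.1 (hy'.snd_eq hw)

/-- Covers the zero load, which the supremum in `kappaH` leaves out and for which the bound reads 0
even if the constant is infinite. -/
theorem IsGalerkin.norm_sub_eq_zero {S : TetMesh Ω} {k : ℕ} {z w : L2v Ω × L2m Ω}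
    (hz : IsVarSol (graphV Ω) 0 z) (hw : IsGalerkin (graphVh S k) z w) : ‖z.2 - w.2‖ = 0 := by
  have h1 : z.2 = 0 := by
    have := hz.2 z hz.1
    rwa [inner_zero_left, inner_self_eq_zero] at this
  refine le_antisymm ?_ (norm_nonneg _)
  have h2 := hw.norm_sub_le (graphVh S k).zero_mem
  rwa [Prod.snd_zero, sub_zero, h1, norm_zero, ← h1] at h2

theorem IsGalerkin.enorm_sub_le_kappaH (hΩ : IsOpen Ω) {T S : TetMesh Ω} {k d m : ℕ} {g : L2v Ω}
    (hg : g ∈ Xh T d) {z w : L2v Ω × L2m Ω} (hz : IsVarSol (graphV Ω) g z)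
    (hw : IsGalerkin (graphVh S k) z w) :
    ‖z.2 - w.2‖ₑ ≤ kappaH T S k d m * ‖g‖ₑ := by
  by_cases h0 : g = 0
  · subst h0
    rw [← ofReal_norm, hw.norm_sub_eq_zero hz]
    simp
  rw [← ENNReal.div_le_iff (by simpa using h0) (by simp)]
  refine le_trans ?_ (le_iSup₂_of_le (f := fun g _ => ⨆ (_ : g ≠ 0),
    ⨅ p ∈ admissible T k m g, ⨅ v ∈ Vh S k, ‖p - gradV v‖ₑ / ‖g‖ₑ) g hg
      (le_iSup_of_le h0 le_rfl))
  refine le_iInf₂ fun p hp => le_iInf₂ fun v hv => ENNReal.div_le_div_right ?_ _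
  have h1 : ‖z.2 - w.2‖ ≤ ‖p - gradV v‖ :=
    IsGalerkin.norm_sub_le_of_equilibrium (y := (v, gradV v)) (graphVh_le S k) hz hw
      (mem_graphVh_of_mem_Vh hΩ hv) fun y hy => inner_snd_of_mem_admissible hΩ hp hy
  rw [← ofReal_norm, ← ofReal_norm]
  exact ENNReal.ofReal_le_ofReal h1

theorem enorm_sub_piH_le (hΩ : IsOpen Ω) (T : TetMesh Ω) (r : ℕ) {z : L2v Ω × L2m Ω}
    (hz : z ∈ graphV Ω) : ‖z.1 - piH T r z.1‖ₑ ≤ C0h T r * ‖z.2‖ₑ := by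
  by_cases h0 : z.1 = 0
  · simp [h0, piH]
  -- By Poincaré, the quotient in `C0h` has a nonzero denominator.
  have h1 : z.2 ≠ 0 := fun h => h0 (fst_eq_of_snd_eq T.isBounded hz (graphV Ω).zero_mem h)
  rw [← ENNReal.div_le_iff (by simpa using h1) (by simp), ← gradV_fst hΩ hz]
  exact le_iSup₂_of_le z.1 (fst_mem_V hz) (le_iSup_of_le h0 le_rfl)

theorem Xh_mono (T : TetMesh Ω) {r d : ℕ} (h : r ≤ d) : Xh T r ≤ Xh T d := by
  intro f hf i K hK
  obtain ⟨q, hq, hq'⟩ := hf i K hK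
  exact ⟨q, hq.trans h, hq'⟩

theorem Ch_eq_top {T S : TetMesh Ω} {k d m r : ℕ}
    (h : kappaH T S k d m = ⊤ ∨ C0h T r = ⊤) : Ch T S k d m r = ⊤ := by
  rcases h with h | h <;> simp [Ch, h]

theorem Ch_eq_ofReal {T S : TetMesh Ω} {k d m r : ℕ} (h1 : kappaH T S k d m ≠ ⊤)
    (h2 : C0h T r ≠ ⊤) : Ch T S k d m r =
      ENNReal.ofReal √((kappaH T S k d m).toReal ^ 2 + (C0h T r).toReal ^ 2) := by
  rw [Ch, Real.sqrt_eq_rpow, ← ENNReal.ofReal_rpow_of_nonneg (by positivity) (by norm_num),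
    ENNReal.ofReal_add (by positivity) (by positivity), ENNReal.ofReal_pow ENNReal.toReal_nonneg,
    ENNReal.ofReal_pow ENNReal.toReal_nonneg, ENNReal.ofReal_toReal h1, ENNReal.ofReal_toReal h2]

theorem norm_le_toReal_mul_norm {E F : Type*} [NormedAddCommGroup E] [NormedAddCommGroup F]
    {a : E} {b : F} {C : ℝ≥0∞} (hC : C ≠ ⊤) (h : ‖a‖ₑ ≤ C * ‖b‖ₑ) : ‖a‖ ≤ C.toReal * ‖b‖ := by
  have := ENNReal.toReal_mono (ENNReal.mul_ne_top hC enorm_ne_top) h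
  rwa [ENNReal.toReal_mul, toReal_enorm, toReal_enorm] at this

theorem enorm_le_ofReal_mul_enorm {E F : Type*} [NormedAddCommGroup E] [NormedAddCommGroup F]
    {a : E} {b : F} {C : ℝ} (hC : 0 ≤ C) (h : ‖a‖ ≤ C * ‖b‖) : ‖a‖ₑ ≤ ENNReal.ofReal C * ‖b‖ₑ := by
  rw [← ofReal_norm, ← ofReal_norm, ← ENNReal.ofReal_mul hC]
  exact ENNReal.ofReal_le_ofReal h

theorem IsGalerkin.error_bounds (hΩ : IsOpen Ω) {T S : TetMesh Ω} {k d m r : ℕ} (hr : r ≤ d)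
    {f : L2v Ω} {z w : L2v Ω × L2m Ω} (hz : IsVarSol (graphV Ω) f z)
    (hw : IsGalerkin (graphVh S k) z w) :
    ‖z.2 - w.2‖ₑ ≤ Ch T S k d m r * ‖f‖ₑ ∧ ‖z.1 - w.1‖ₑ ≤ Ch T S k d m r * ‖z.2 - w.2‖ₑ := by
  have := finiteDimensional_graphVh hΩ S k
  -- If C_h = ∞, the bounds have content only where ∞ · 0 = 0 on the right; there the left side
  -- vanishes too.
  by_cases htop : kappaH T S k d m = ⊤ ∨ C0h T r = ⊤
  · rw [Ch_eq_top htop]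
    constructor
    · by_cases h0 : f = 0
      · subst h0
        rw [← ofReal_norm, hw.norm_sub_eq_zero hz]
        simp
      · rw [ENNReal.top_mul (by simpa using h0)]
        exact le_top
    · by_cases h0 : z.2 - w.2 = 0
      · rw [fst_eq_of_snd_eq S.isBounded hz.1 hw.1.1 (sub_eq_zero.1 h0)]
        simp
      · rw [ENNReal.top_mul (by simpa using h0)]
        exact le_top
  · obtain ⟨h1, h2⟩ := not_or.1 htop
    rw [Ch_eq_ofReal h1 h2]
    obtain ⟨C, hC⟩ := exists_norm_fst_le T.isBounded
    have hsol : ∀ g, ∃ z, IsVarSol (graphV Ω) g z := exists_isVarSol isClosed_graphV hC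
    -- Here r ≤ d is needed: projected loads must lie in X_h for κ_h to apply.
    have hκ : ∀ g ∈ Xh T r, ∀ z w, IsVarSol (graphV Ω) g z → IsGalerkin (graphVh S k) z w →
        ‖z.2 - w.2‖ ≤ (kappaH T S k d m).toReal * ‖g‖ := fun g hg z w hz hw =>
      norm_le_toReal_mul_norm h1 (hw.enorm_sub_le_kappaH hΩ (Xh_mono T hr hg) hz)
    have hest := fun (g : L2v Ω) z w (hz : IsVarSol (graphV Ω) g z)
        (hw : IsGalerkin (graphVh S k) z w) =>
      IsGalerkin.norm_sub_le_of_projection (X := Xh T r) ENNReal.toReal_nonneg hsol hκ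
        (fun w hw => norm_le_toReal_mul_norm h2 (enorm_sub_piH_le hΩ T r hw)) hz hw
    exact ⟨enorm_le_ofReal_mul_enorm (Real.sqrt_nonneg _) (hest f z w hz hw),
      enorm_le_ofReal_mul_enorm (Real.sqrt_nonneg _)
        (IsGalerkin.norm_fst_sub_le (graphVh_le S k) hsol hest hz.1 hw (Real.sqrt_nonneg _))⟩

end Discrete

end Stokes

theorem mainTheorem2 (Ω : Set Stokes.E3) (hΩ : IsOpen Ω) (T S : Stokes.TetMesh Ω)
    (k d m r : ℕ) (hr : r ≤ d) (f : Stokes.L2v Ω) :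
    (∃! u : Stokes.L2v Ω, Stokes.IsStokesSolution f u) ∧
    (∀ v ∈ Stokes.V Ω, ∃! w : Stokes.L2v Ω, Stokes.IsPh S k v w) ∧
    ∀ u Pu : Stokes.L2v Ω, Stokes.IsStokesSolution f u → Stokes.IsPh S k u Pu →
      ‖Stokes.gradV (u - Pu)‖ₑ ≤ Stokes.Ch T S k d m r * ‖f‖ₑ ∧
      ‖u - Pu‖ₑ ≤ Stokes.Ch T S k d m r * ‖Stokes.gradV (u - Pu)‖ₑ := by
  refine ⟨Stokes.existsUnique_isStokesSolution hΩ T.isBounded f,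
    fun v hv => Stokes.existsUnique_isPh hΩ S k hv, fun u Pu hu hPu => ?_⟩
  rw [Stokes.gradV_sub hΩ hu.1 hPu.1.1]
  have hz := (Stokes.isStokesSolution_iff hΩ).1 hu
  have hw := (Stokes.isPh_iff hΩ hu.1).1 hPu
  have h := Stokes.IsGalerkin.error_bounds (T := T) (m := m) hΩ hr hz hw
  exact h
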